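/- Let $2<p<\infty$, let $\mu$ be an arbitrary (not necessarily $\sigma$-finite) measure on a measurable space, and let $X$ be a closed linear subspace of $L_p=L_p(\mu)$, the scalar field being $\mathbb{R}$ or $\mathbb{C}$. Write $\ell_p(\aleph_1)$ for the space $\ell_p(I)$ over an index set $I$ of cardinality $\aleph_1$. The following are equivalent: (1) $\ell_p(\aleph_1)$ embeds isometrically into $X$, i.e. there is a linear isometry from $\ell_p(\aleph_1)$ into $X$; (2) there is a linear subspace $Y\subseteq X$ that is linearly homeomorphic to $\ell_p(\aleph_1)$ and is complemented in $L_p(\mu)$, i.e. $Y$ is the range of a bounded linear projection on $L_p(\mu)$; (3) $\ell_p(\aleph_1)$ embeds isomorphically into $X$, i.e. $\ell_p(\aleph_1)$ is linearly homeomorphic to a linear subspace of $X$; (4) there is no injective bounded linear operator from $X$ into a Hilbert space (over the same scalar field). -/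

import Mathlib

open MeasureTheory
open scoped ENNReal

universe u v w

/-! Everything turns on disjoint families in `X`. By Zorn, `X` contains a maximal family of
normalized, pairwise disjoint functions. If it were countable, a weighted sum `G` of their moduli
would lie in `L_p`, and by Hölder `f ↦ f · G ^ ((p - 2) / 2)` would map `L_p` boundedly into `L_2`.
An `f ∈ X` in its kernel is disjoint from the family, hence zero by maximality, so the map is
injective on `X`, against (4). Thus (4) yields `ℵ₁` disjoint normalized functions; these span an
isometric `ℓ_p(ℵ₁)` inside `X` that is complemented in `L_p` (`lpEmbedding`,
`closedComplemented_range_lpEmbedding`).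

Conversely, Hilbert spaces have cotype 2 (`exists_signs_sum_sq_norm_le`). An injective operator on
an uncountable `ℓ_p` is bounded below on infinitely many unit vectors, which forces `N ≲ N ^ (2 /
p)` for all `N`, impossible for `p > 2`. -/

/-- In an inner product space signs can be chosen so that a sum dominates the `ℓ²` sum. -/
theorem exists_signs_sum_sq_norm_le {𝕜 H ι : Type*} [RCLike 𝕜] [NormedAddCommGroup H]
    [InnerProductSpace 𝕜 H] (x : ι → H) (s : Finset ι) :
    ∃ ε : ι → 𝕜, (∀ i, ‖ε i‖ = 1) ∧ ∑ i ∈ s, ‖x i‖ ^ 2 ≤ ‖∑ i ∈ s, ε i • x i‖ ^ 2 := by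
  classical
  induction s using Finset.induction_on with
  | empty => exact ⟨fun _ => 1, by simp, by simp⟩
  | insert j s hj ih =>
    obtain ⟨ε, hε, hs⟩ := ih
    have key : ∃ δ : 𝕜, ‖δ‖ = 1 ∧
        ‖x j‖ ^ 2 + ‖∑ i ∈ s, ε i • x i‖ ^ 2 ≤ ‖δ • x j + ∑ i ∈ s, ε i • x i‖ ^ 2 := by
      -- The two squared norms average to the sum of squares, so the larger one dominates it.
      have h := parallelogram_law_with_norm 𝕜 (∑ i ∈ s, ε i • x i) (x j)
      rcases le_total ‖(∑ i ∈ s, ε i • x i) - x j‖ ‖(∑ i ∈ s, ε i • x i) + x j‖ with hle | hle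
      · refine ⟨1, by simp, ?_⟩
        rw [one_smul, add_comm (x j)]
        nlinarith [norm_nonneg ((∑ i ∈ s, ε i • x i) - x j)]
      · refine ⟨-1, by simp, ?_⟩
        rw [neg_one_smul, neg_add_eq_sub]
        nlinarith [norm_nonneg ((∑ i ∈ s, ε i • x i) + x j)]
    obtain ⟨δ, hδ, hle⟩ := key
    refine ⟨Function.update ε j δ, fun i => ?_, ?_⟩
    · by_cases h : i = j
      · subst h; simpa using hδ
      · simpa [h] using hε i
    · have : ∑ i ∈ s, Function.update ε j δ i • x i = ∑ i ∈ s, ε i • x i :=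
        Finset.sum_congr rfl fun i hi => by
          rw [Function.update_of_ne (ne_of_mem_of_not_mem hi hj)]
      rw [Finset.sum_insert hj, Finset.sum_insert hj, this, Function.update_self]
      linarith

/-- An uncountable `ℓ_p` space with `p > 2` has no injective bounded operator into an inner
product space. -/
theorem lp.not_injective_of_uncountable {𝕜 H ι : Type*} [RCLike 𝕜] [NormedAddCommGroup H]
    [InnerProductSpace 𝕜 H] [Uncountable ι] {p : ℝ≥0∞} [Fact (1 ≤ p)] (hp : 2 < p) (hp_top : p < ∞)
    (T : lp (fun _ : ι => 𝕜) p →L[𝕜] H) : ¬ Function.Injective T := by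
  classical
  intro hT
  have hp2 : 2 < p.toReal := by
    have := (ENNReal.toReal_lt_toReal (by simp) hp_top.ne).2 hp
    simpa using this
  set e : ι → lp (fun _ : ι => 𝕜) p := fun i => lp.single p i (1 : 𝕜) with he
  have hpos : ∀ i, 0 < ‖T (e i)‖ := by
    intro i
    rw [norm_pos_iff, Ne, map_eq_zero_iff T hT]
    intro h
    have := congrArg (fun f : lp (fun _ : ι => 𝕜) p => f i) h
    simp [he] at this
  -- Uncountably many positive numbers cannot all have finite level sets above `1 / (n + 1)`.
  obtain ⟨n, hn⟩ : ∃ n : ℕ, {i | 1 / ((n : ℝ) + 1) < ‖T (e i)‖}.Infinite := by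
    by_contra! hcon
    have hU : (⋃ n : ℕ, {i | 1 / ((n : ℝ) + 1) < ‖T (e i)‖}).Countable :=
      Set.countable_iUnion fun n => (hcon n).countable
    refine Set.not_countable_univ (hU.mono fun i _ => ?_)
    obtain ⟨n, hn⟩ := exists_nat_one_div_lt (hpos i)
    exact Set.mem_iUnion.2 ⟨n, hn⟩
  set δ : ℝ := 1 / ((n : ℝ) + 1) with hδ
  have hδ0 : 0 < δ := by positivity
  -- Compare `N δ² ≤ ∑ ‖T eᵢ‖²` with `‖T (∑ εᵢ eᵢ)‖² ≤ ‖T‖² N ^ (2 / p)`.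
  have bound : ∀ N : ℕ, 0 < N → (N : ℝ) ^ (1 - 2 / p.toReal) ≤ ‖T‖ ^ 2 / δ ^ 2 := by
    intro N hN
    obtain ⟨s, hs, hcard⟩ := hn.exists_subset_card_eq N
    obtain ⟨ε, hε, hle⟩ := exists_signs_sum_sq_norm_le (𝕜 := 𝕜) (fun i => T (e i)) s
    have h1 : (N : ℝ) * δ ^ 2 ≤ ∑ i ∈ s, ‖T (e i)‖ ^ 2 := by
      rw [← hcard, ← nsmul_eq_mul]
      refine Finset.card_nsmul_le_sum _ _ _ fun i hi => ?_
      have : δ < ‖T (e i)‖ := hs hi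
      gcongr
    have h2 : ∑ i ∈ s, ε i • T (e i) = T (∑ i ∈ s, lp.single p i (ε i)) := by
      rw [map_sum]
      refine Finset.sum_congr rfl fun i _ => ?_
      rw [← map_smul, he, ← lp.single_smul]
      simp
    have h3 : ‖∑ i ∈ s, (lp.single p i (ε i) : lp (fun _ : ι => 𝕜) p)‖ =
        (N : ℝ) ^ (1 / p.toReal) := by
      have h := lp.norm_sum_single (E := fun _ : ι => 𝕜) (p := p) (by linarith) ε s
      simp only [hε, Real.one_rpow, Finset.sum_const, hcard, nsmul_eq_mul, mul_one] at h
      rw [← h, ← Real.rpow_mul (norm_nonneg _), mul_one_div_cancel (by linarith), Real.rpow_one]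
    have hN0 : (0 : ℝ) < N := by exact_mod_cast hN
    have h4 : (N : ℝ) * δ ^ 2 ≤ ‖T‖ ^ 2 * (N : ℝ) ^ (2 / p.toReal) := by
      calc (N : ℝ) * δ ^ 2 ≤ ‖∑ i ∈ s, ε i • T (e i)‖ ^ 2 := h1.trans hle
        _ ≤ (‖T‖ * (N : ℝ) ^ (1 / p.toReal)) ^ 2 := by
          rw [h2, ← h3]; gcongr; exact T.le_opNorm _
        _ = ‖T‖ ^ 2 * (N : ℝ) ^ (2 / p.toReal) := by
          rw [mul_pow, ← Real.rpow_natCast ((N : ℝ) ^ _), ← Real.rpow_mul hN0.le]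
          congr 2; push_cast; ring
    rw [Real.rpow_sub hN0, Real.rpow_one, div_le_div_iff₀ (by positivity) (by positivity)]
    exact h4
  have hexp : 0 < 1 - 2 / p.toReal := by
    rw [sub_pos, div_lt_one (by linarith)]; exact hp2
  have ht := ((tendsto_rpow_atTop hexp).comp tendsto_natCast_atTop_atTop).eventually_gt_atTop
    (‖T‖ ^ 2 / δ ^ 2)
  obtain ⟨N, hN, hN0⟩ := (ht.and (Filter.eventually_gt_atTop 0)).exists
  exact absurd (bound N hN0) (not_le.2 hN)

/-! ### Disjoint families in `L_p` and the copies of `ℓ_p` they span -/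

namespace MeasureTheory.Lp

section Disjoint

variable {𝕜 : Type w} [RCLike 𝕜] {Ω : Type u} [MeasurableSpace Ω] {μ : Measure Ω} {p : ℝ≥0∞}
  {ι : Type v}

/-- Two elements of `L_p` are disjoint if almost everywhere one of them vanishes. -/
def AEDisjointSupport (f g : Lp 𝕜 p μ) : Prop := ∀ᵐ a ∂μ, f a = 0 ∨ g a = 0

theorem AEDisjointSupport.symm {f g : Lp 𝕜 p μ} (h : AEDisjointSupport f g) :
    AEDisjointSupport g f :=
  Filter.Eventually.mono h fun _ => Or.symm

theorem AEDisjointSupport.smul_left {f g : Lp 𝕜 p μ} (h : AEDisjointSupport f g) (c : 𝕜) :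
    AEDisjointSupport (c • f) g := by
  filter_upwards [h, Lp.coeFn_smul c f] with a h1 h2
  rw [h2, Pi.smul_apply]
  exact h1.imp_left fun h => by rw [h, smul_zero]

theorem AEDisjointSupport.add_left {f f' g : Lp 𝕜 p μ} (h : AEDisjointSupport f g)
    (h' : AEDisjointSupport f' g) : AEDisjointSupport (f + f') g := by
  filter_upwards [h, h', Lp.coeFn_add f f'] with a h1 h2 h3
  rw [h3, Pi.add_apply]
  rcases h1 with h1 | h1
  · rcases h2 with h2 | h2
    · left; rw [h1, h2, add_zero]
    · exact Or.inr h2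
  · exact Or.inr h1

theorem AEDisjointSupport.zero_left (g : Lp 𝕜 p μ) : AEDisjointSupport 0 g := by
  filter_upwards [Lp.coeFn_zero 𝕜 p μ] with a h
  exact Or.inl h

theorem AEDisjointSupport.sum_left {f : ι → Lp 𝕜 p μ} {g : Lp 𝕜 p μ} {s : Finset ι}
    (h : ∀ i ∈ s, AEDisjointSupport (f i) g) : AEDisjointSupport (∑ i ∈ s, f i) g :=
  Finset.sum_induction f (AEDisjointSupport · g) (fun _ _ => AEDisjointSupport.add_left)
    (AEDisjointSupport.zero_left g) h

theorem norm_rpow_eq_toReal_lintegral (hp0 : p ≠ 0) (hp_top : p ≠ ∞) (f : Lp 𝕜 p μ) :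
    ‖f‖ ^ p.toReal = (∫⁻ a, ‖f a‖ₑ ^ p.toReal ∂μ).toReal := by
  have h0 : p.toReal ≠ 0 := (ENNReal.toReal_pos hp0 hp_top).ne'
  rw [Lp.norm_def, eLpNorm_eq_lintegral_rpow_enorm_toReal hp0 hp_top, ENNReal.toReal_rpow,
    ← ENNReal.rpow_mul, one_div_mul_cancel h0, ENNReal.rpow_one]

theorem lintegral_rpow_enorm_ne_top (hp0 : p ≠ 0) (hp_top : p ≠ ∞) (f : Lp 𝕜 p μ) :
    ∫⁻ a, ‖f a‖ₑ ^ p.toReal ∂μ ≠ ∞ :=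
  (lintegral_rpow_enorm_lt_top_of_eLpNorm_lt_top hp0 hp_top (Lp.memLp f).2).ne

theorem AEDisjointSupport.norm_add_rpow {f g : Lp 𝕜 p μ} (h : AEDisjointSupport f g)
    (hp0 : p ≠ 0) (hp_top : p ≠ ∞) :
    ‖f + g‖ ^ p.toReal = ‖f‖ ^ p.toReal + ‖g‖ ^ p.toReal := by
  have h0 : 0 < p.toReal := ENNReal.toReal_pos hp0 hp_top
  rw [norm_rpow_eq_toReal_lintegral hp0 hp_top, norm_rpow_eq_toReal_lintegral hp0 hp_top,
    norm_rpow_eq_toReal_lintegral hp0 hp_top,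
    ← ENNReal.toReal_add (lintegral_rpow_enorm_ne_top hp0 hp_top f)
      (lintegral_rpow_enorm_ne_top hp0 hp_top g),
    ← lintegral_add_left' ((Lp.aestronglyMeasurable f).enorm.pow_const _)]
  congr 1
  refine lintegral_congr_ae ?_
  filter_upwards [h, Lp.coeFn_add f g] with a h1 h2
  rw [h2, Pi.add_apply]
  rcases h1 with h1 | h1 <;> simp [h1, h0]

variable [Fact (1 ≤ p)]

theorem norm_sum_smul_rpow_of_disjoint (hp0 : p ≠ 0) (hp_top : p ≠ ∞) {x : ι → Lp 𝕜 p μ}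
    (hx : ∀ i, ‖x i‖ = 1) (hd : Pairwise fun i j => AEDisjointSupport (x i) (x j)) (c : ι → 𝕜)
    (s : Finset ι) : ‖∑ i ∈ s, c i • x i‖ ^ p.toReal = ∑ i ∈ s, ‖c i‖ ^ p.toReal := by
  classical
  have h0 : 0 < p.toReal := ENNReal.toReal_pos hp0 hp_top
  induction s using Finset.induction_on with
  | empty => simp [h0.ne']
  | insert j s hj ih =>
    have hdis : AEDisjointSupport (∑ i ∈ s, c i • x i) (c j • x j) :=
      AEDisjointSupport.sum_left fun i hi =>
        (((hd (ne_of_mem_of_not_mem hi hj)).smul_left (c i)).symm.smul_left (c j)).symm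
    rw [Finset.sum_insert hj, Finset.sum_insert hj, hdis.symm.norm_add_rpow hp0 hp_top, ih,
      norm_smul, hx, mul_one]

/-- The `p`-th power of the norm of a finite partial sum equals that of its coefficients, so the
Cauchy criterion transfers from `∑ ‖c i‖ ^ p`. -/
theorem summable_smul_of_disjoint (hp_top : p ≠ ∞) {x : ι → Lp 𝕜 p μ}
    (hx : ∀ i, ‖x i‖ = 1) (hd : Pairwise fun i j => AEDisjointSupport (x i) (x j))
    (c : lp (fun _ : ι => 𝕜) p) : Summable fun i => c i • x i := by
  have hp0 : p ≠ 0 := (zero_lt_one.trans_le Fact.out).ne'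
  have h0 : 0 < p.toReal := ENNReal.toReal_pos hp0 hp_top
  rw [summable_iff_vanishing_norm]
  intro ε hε
  obtain ⟨s, hs⟩ := summable_iff_vanishing_norm.1 ((lp.memℓp c).summable h0) (ε ^ p.toReal)
    (by positivity)
  refine ⟨s, fun t ht => ?_⟩
  have h := hs t ht
  rw [← norm_sum_smul_rpow_of_disjoint hp0 hp_top hx hd, Real.norm_of_nonneg (by positivity)] at h
  exact (Real.rpow_lt_rpow_iff (norm_nonneg _) hε.le h0).1 h

/-- The isometric embedding of `ℓ_p` into `L_p` given by a normalized disjoint family. -/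
noncomputable def lpEmbedding (hp_top : p ≠ ∞) {x : ι → Lp 𝕜 p μ}
    (hx : ∀ i, ‖x i‖ = 1) (hd : Pairwise fun i j => AEDisjointSupport (x i) (x j)) :
    lp (fun _ : ι => 𝕜) p →ₗᵢ[𝕜] Lp 𝕜 p μ where
  toFun c := ∑' i, c i • x i
  map_add' c d := by
    rw [← (summable_smul_of_disjoint hp_top hx hd c).tsum_add
      (summable_smul_of_disjoint hp_top hx hd d)]
    simp only [lp.coeFn_add, Pi.add_apply, add_smul]
  map_smul' a c := by
    rw [RingHom.id_apply, ← (summable_smul_of_disjoint hp_top hx hd c).tsum_const_smul]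
    simp only [lp.coeFn_smul, Pi.smul_apply, smul_assoc]
  norm_map' c := by
    have hp0 : p ≠ 0 := (zero_lt_one.trans_le Fact.out).ne'
    have h0 : 0 < p.toReal := ENNReal.toReal_pos hp0 hp_top
    have h1 := ((summable_smul_of_disjoint hp_top hx hd c).hasSum.norm).rpow_const
      (p := p.toReal) (Or.inr h0.le)
    simp only [norm_sum_smul_rpow_of_disjoint hp0 hp_top hx hd] at h1
    have h2 := tendsto_nhds_unique h1 (lp.hasSum_norm h0 c)
    exact (Real.rpow_left_inj (norm_nonneg _) (norm_nonneg _) h0.ne').1 h2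

theorem hasSum_lpEmbedding (hp_top : p ≠ ∞) {x : ι → Lp 𝕜 p μ}
    (hx : ∀ i, ‖x i‖ = 1) (hd : Pairwise fun i j => AEDisjointSupport (x i) (x j))
    (c : lp (fun _ : ι => 𝕜) p) : HasSum (fun i => c i • x i) (lpEmbedding hp_top hx hd c) :=
  (summable_smul_of_disjoint hp_top hx hd c).hasSum

theorem lpEmbedding_mem (hp_top : p ≠ ∞) {x : ι → Lp 𝕜 p μ}
    (hx : ∀ i, ‖x i‖ = 1) (hd : Pairwise fun i j => AEDisjointSupport (x i) (x j))
    {X : Submodule 𝕜 (Lp 𝕜 p μ)} (hX : IsClosed (X : Set (Lp 𝕜 p μ))) (hxX : ∀ i, x i ∈ X)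
    (c : lp (fun _ : ι => 𝕜) p) : lpEmbedding hp_top hx hd c ∈ X :=
  hX.mem_of_tendsto (hasSum_lpEmbedding hp_top hx hd c)
    (Filter.Eventually.of_forall fun _ => X.sum_mem fun i _ => X.smul_mem _ (hxX i))

theorem norm_restrict_rpow (hp_top : p ≠ ∞) (S : Set Ω) (f : Lp 𝕜 p μ) :
    ‖LpToLpRestrictCLM Ω 𝕜 𝕜 μ p S f‖ ^ p.toReal =
      (∫⁻ a in S, ‖f a‖ₑ ^ p.toReal ∂μ).toReal := by
  have hp0 : p ≠ 0 := (zero_lt_one.trans_le Fact.out).ne'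
  rw [norm_rpow_eq_toReal_lintegral hp0 hp_top]
  congr 1
  refine lintegral_congr_ae ?_
  filter_upwards [LpToLpRestrictCLM_coeFn 𝕜 S f] with a ha
  rw [ha]

theorem sum_norm_restrict_rpow_le (hp_top : p ≠ ∞) {S : ι → Set Ω}
    (hS : ∀ i, MeasurableSet (S i)) (hd : Pairwise fun i j => AEDisjoint μ (S i) (S j))
    (f : Lp 𝕜 p μ) (s : Finset ι) :
    ∑ i ∈ s, ‖LpToLpRestrictCLM Ω 𝕜 𝕜 μ p (S i) f‖ ^ p.toReal ≤ ‖f‖ ^ p.toReal := by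
  have hp0 : p ≠ 0 := (zero_lt_one.trans_le Fact.out).ne'
  have hfin := lintegral_rpow_enorm_ne_top hp0 hp_top f
  simp only [norm_restrict_rpow hp_top]
  rw [norm_rpow_eq_toReal_lintegral hp0 hp_top, ← ENNReal.toReal_sum fun i _ =>
    ne_top_of_le_ne_top hfin (setLIntegral_le_lintegral _ _),
    ← lintegral_biUnion_finset₀ (fun i _ j _ hij => hd hij) fun i _ => (hS i).nullMeasurableSet]
  exact ENNReal.toReal_mono hfin (setLIntegral_le_lintegral _ _)

/-- Coordinate functionals of a normalized disjoint family, dominated by the norms of the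
restrictions to the supports. -/
theorem exists_coord_of_disjoint (hp_top : p ≠ ∞) {x : ι → Lp 𝕜 p μ} (hx : ∀ i, ‖x i‖ = 1)
    (hd : Pairwise fun i j => AEDisjointSupport (x i) (x j)) :
    ∃ φ : ι → Lp 𝕜 p μ →L[𝕜] 𝕜, (∀ i, φ i (x i) = 1) ∧ (∀ i j, i ≠ j → φ i (x j) = 0) ∧
      ∀ f (s : Finset ι), ∑ i ∈ s, ‖φ i f‖ ^ p.toReal ≤ ‖f‖ ^ p.toReal := by
  have hp0 : p ≠ 0 := (zero_lt_one.trans_le Fact.out).ne'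
  have h0 : 0 < p.toReal := ENNReal.toReal_pos hp0 hp_top
  set S : ι → Set Ω := fun i => Function.support (x i)
  have hS : ∀ i, MeasurableSet (S i) := fun i => (Lp.stronglyMeasurable (x i)).measurableSet_support
  have hSd : Pairwise fun i j => AEDisjoint μ (S i) (S j) := by
    intro i j hij
    have h : ∀ᵐ a ∂μ, ¬ a ∈ S i ∩ S j := by
      filter_upwards [hd hij] with a ha hmem
      exact ha.elim hmem.1 hmem.2
    rw [ae_iff] at h
    simpa [AEDisjoint] using h
  let R : (i : ι) → Lp 𝕜 p μ →L[𝕜] Lp 𝕜 p (μ.restrict (S i)) := fun i =>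
    LpToLpRestrictCLM Ω 𝕜 𝕜 μ p (S i)
  have hR1 : ∀ i, ‖R i (x i)‖ = 1 := by
    intro i
    have h1 : ‖R i (x i)‖ ^ p.toReal = ‖x i‖ ^ p.toReal := by
      rw [norm_restrict_rpow hp_top, norm_rpow_eq_toReal_lintegral hp0 hp_top,
        setLIntegral_eq_of_support_subset]
      intro a ha hxa
      exact ha (by simp [hxa, h0])
    rw [hx] at h1
    exact (Real.rpow_left_inj (norm_nonneg _) zero_le_one h0.ne').1 h1
  have hR0 : ∀ i j, i ≠ j → R i (x j) = 0 := by
    intro i j hij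
    rw [Lp.eq_zero_iff_ae_eq_zero]
    filter_upwards [LpToLpRestrictCLM_coeFn 𝕜 (S i) (x j), ae_restrict_mem (hS i),
      ae_restrict_of_ae (hd hij)] with a h1 h2 h3
    rw [h1]
    exact h3.resolve_left h2
  -- Hahn–Banach on each restricted space supplies the functionals, so no description of the dual of
  -- `L_p(μ)` is needed and `μ` may be arbitrary.
  choose ψ hψ hψx using fun i => exists_dual_vector'' 𝕜 (R i (x i))
  refine ⟨fun i => (ψ i).comp (R i), fun i => ?_, fun i j hij => ?_, fun f s => ?_⟩
  · rw [ContinuousLinearMap.comp_apply, hψx, hR1, RCLike.ofReal_one]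
  · rw [ContinuousLinearMap.comp_apply, hR0 i j hij, map_zero]
  · refine (Finset.sum_le_sum fun i _ => ?_).trans (sum_norm_restrict_rpow_le hp_top hS hSd f s)
    refine Real.rpow_le_rpow (norm_nonneg _) ?_ h0.le
    exact (ψ i).le_of_opNorm_le (hψ i) _ |>.trans_eq (one_mul _)

/-- The span of a normalized disjoint family is the range of a contractive projection. -/
theorem closedComplemented_range_lpEmbedding (hp_top : p ≠ ∞) {x : ι → Lp 𝕜 p μ}
    (hx : ∀ i, ‖x i‖ = 1) (hd : Pairwise fun i j => AEDisjointSupport (x i) (x j)) :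
    (LinearMap.range (lpEmbedding hp_top hx hd).toLinearMap).ClosedComplemented := by
  have hp0 : p ≠ 0 := (zero_lt_one.trans_le Fact.out).ne'
  have h0 : 0 < p.toReal := ENNReal.toReal_pos hp0 hp_top
  obtain ⟨φ, hφ1, hφ0, hφ⟩ := exists_coord_of_disjoint hp_top hx hd
  set J := lpEmbedding hp_top hx hd
  let Q : Lp 𝕜 p μ →ₗ[𝕜] lp (fun _ : ι => 𝕜) p :=
    { toFun := fun f => ⟨fun i => φ i f, memℓp_gen' (hφ f)⟩
      map_add' := fun f g => by ext i; exact map_add (φ i) f g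
      map_smul' := fun c f => by ext i; exact map_smul (φ i) c f }
  let Q' : Lp 𝕜 p μ →L[𝕜] lp (fun _ : ι => 𝕜) p := Q.mkContinuous 1 fun f => by
    rw [one_mul]
    exact lp.norm_le_of_forall_sum_le h0 (norm_nonneg _) (hφ f)
  -- A left inverse `Q'` of `J` makes `J ∘ Q'` a projection onto the range of `J`.
  have hQJ : ∀ c, Q' (J c) = c := by
    intro c
    ext i
    have h1 : HasSum (fun j => φ i (c j • x j)) (φ i (J c)) :=
      (hasSum_lpEmbedding hp_top hx hd c).mapL (φ i)
    have h2 : HasSum (fun j => φ i (c j • x j)) (φ i (c i • x i)) :=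
      hasSum_single i fun j hj => by rw [map_smul, hφ0 i j hj.symm, smul_zero]
    rw [map_smul, hφ1, smul_eq_mul, mul_one] at h2
    exact h1.unique h2
  refine ⟨(J.toContinuousLinearMap.comp Q').codRestrict _ fun f => ⟨Q' f, rfl⟩, ?_⟩
  rintro ⟨_, c, rfl⟩
  exact Subtype.ext (congrArg J (hQJ c))

/-- Every subspace of `L_p` contains a maximal normalized disjoint family. -/
theorem exists_maximal_disjoint (X : Submodule 𝕜 (Lp 𝕜 p μ)) :
    ∃ F : Set (Lp 𝕜 p μ), (∀ x ∈ F, x ∈ X ∧ ‖x‖ = 1) ∧ F.Pairwise AEDisjointSupport ∧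
      ∀ f ∈ X, (∀ x ∈ F, AEDisjointSupport f x) → f = 0 := by
  obtain ⟨F, hF⟩ := zorn_subset
    {F : Set (Lp 𝕜 p μ) | (∀ x ∈ F, x ∈ X ∧ ‖x‖ = 1) ∧ F.Pairwise AEDisjointSupport} (by
      intro c hc hchain
      refine ⟨⋃₀ c, ⟨?_, ?_⟩, fun s hs => Set.subset_sUnion_of_mem hs⟩
      · rintro x ⟨s, hs, hx⟩
        exact (hc hs).1 x hx
      · exact hchain.pairwise_sUnion.2 fun s hs => (hc hs).2)
  refine ⟨F, hF.prop.1, hF.prop.2, fun f hf hfd => ?_⟩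
  by_contra hne
  set g : Lp 𝕜 p μ := (‖f‖ : 𝕜)⁻¹ • f
  have hg1 : ‖g‖ = 1 := norm_smul_inv_norm hne
  have hgd : ∀ x ∈ F, AEDisjointSupport g x := fun x hx => (hfd x hx).smul_left _
  -- Maximality forces `g` into `F`; then `g` is disjoint from itself, hence zero.
  have hgF : g ∈ F := by
    refine hF.le_of_ge (y := insert g F) ⟨?_, ?_⟩ (Set.subset_insert _ _) (Set.mem_insert _ _)
    · rintro x (rfl | hx)
      · exact ⟨X.smul_mem _ hf, hg1⟩
      · exact hF.prop.1 x hx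
    · exact hF.prop.2.insert fun x hx _ => ⟨hgd x hx, (hgd x hx).symm⟩
  have hg0 : g = 0 := by
    rw [Lp.eq_zero_iff_ae_eq_zero]
    filter_upwards [hgd g hgF] with a ha
    exact ha.elim id id
  simp [hg0] at hg1

end Disjoint

end MeasureTheory.Lp

/-! ### From countable families to operators into `L_2` -/

/-- Every countable family in `L_p`, `p > 2`, admits a bounded operator `L_p → L_2` whose kernel
consists of functions vanishing on all supports of the family. -/
theorem MeasureTheory.Lp.exists_toL2_of_countable {𝕜 : Type w} [RCLike 𝕜] {Ω : Type u}
    [MeasurableSpace Ω] {μ : Measure Ω} {p : ℝ≥0∞} [Fact (1 ≤ p)] (hp : 2 < p) (hp_top : p < ∞)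
    {F : Set (Lp 𝕜 p μ)} (hF : F.Countable) :
    ∃ T : Lp 𝕜 p μ →L[𝕜] Lp 𝕜 2 μ, ∀ f, T f = 0 → ∀ x ∈ F, ∀ᵐ a ∂μ, f a = 0 ∨ x a = 0 := by
  have hp0 : p ≠ 0 := (zero_lt_two.trans hp).ne'
  have := hF.toEncodable
  obtain ⟨c, hc, C, hC, -⟩ := posSumOfEncodable one_pos F
  -- The weights `c x` are positive and summable; the `+ 1` keeps the denominator positive even when
  -- `x = 0`.
  set g : F → Lp ℝ p μ := fun x => (c x / (‖(x : Lp 𝕜 p μ)‖ + 1)) •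
    (Lp.memLp (x : Lp 𝕜 p μ)).norm.toLp _ with hg
  have hd : ∀ x : F, 0 < c x / (‖(x : Lp 𝕜 p μ)‖ + 1) := fun x => div_pos (hc x) (by positivity)
  have hgae : ∀ x : F, g x =ᵐ[μ] fun a => c x / (‖(x : Lp 𝕜 p μ)‖ + 1) * ‖(x : Lp 𝕜 p μ) a‖ := by
    intro x
    filter_upwards [Lp.coeFn_smul (c x / (‖(x : Lp 𝕜 p μ)‖ + 1))
      ((Lp.memLp (x : Lp 𝕜 p μ)).norm.toLp _), (Lp.memLp (x : Lp 𝕜 p μ)).norm.coeFn_toLp] with a h1 h2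
    rw [hg, h1, Pi.smul_apply, h2, smul_eq_mul]
  have hg0 : ∀ x, 0 ≤ g x := fun x => by
    rw [← Lp.coeFn_nonneg]
    filter_upwards [hgae x] with a ha
    rw [ha]
    have := hd x
    simp only [Pi.zero_apply]
    positivity
  have hsum : Summable g := by
    refine Summable.of_norm_bounded hC.summable fun x => ?_
    rw [hg, norm_smul, Real.norm_of_nonneg (hd x).le, Lp.norm_toLp, eLpNorm_norm, ← Lp.norm_def,
      div_mul_eq_mul_div, div_le_iff₀ (by positivity)]
    nlinarith [hc x, norm_nonneg (x : Lp 𝕜 p μ)]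
  set G := ∑' x, g x with hG
  have hGx : ∀ x : F, ∀ᵐ a ∂μ, G a = 0 → (x : Lp 𝕜 p μ) a = 0 := by
    intro x
    have hle : g x ≤ G := hsum.le_tsum x fun y _ => hg0 y
    rw [← Lp.coeFn_le] at hle
    filter_upwards [hle, hgae x] with a h1 h2 h3
    rw [h2, h3] at h1
    have h4 : ‖(x : Lp 𝕜 p μ) a‖ ≤ 0 := nonpos_of_mul_nonpos_right h1 (hd x)
    simpa using h4
  have hp2 : 2 < p.toReal := by
    have := (ENNReal.toReal_lt_toReal (by simp) hp_top.ne).2 hp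
    simpa using this
  -- `G ^ q` lies in `L_{p/q}`, and Hölder into `L_2` needs `1 / p + q / p = 1 / 2`, i.e. `q = (p -
  -- 2) / 2`.
  set q : ℝ≥0∞ := ENNReal.ofReal ((p.toReal - 2) / 2) with hq
  have hqr : q.toReal = (p.toReal - 2) / 2 := ENNReal.toReal_ofReal (by linarith)
  have hpr : p = ENNReal.ofReal p.toReal := (ENNReal.ofReal_toReal hp_top.ne).symm
  have hr : p / q = ENNReal.ofReal (p.toReal / ((p.toReal - 2) / 2)) := by
    rw [ENNReal.ofReal_div_of_pos (by linarith), ← hpr]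
  have : ENNReal.HolderTriple p (p / q) 2 := by
    refine ⟨?_⟩
    have h2 : (2 : ℝ≥0∞) = ENNReal.ofReal 2 := by simp
    have hd2 : (0 : ℝ) < p.toReal - 2 := by linarith
    rw [hr, h2, hpr, ENNReal.toReal_ofReal (by linarith), ← ENNReal.ofReal_inv_of_pos (by linarith),
      ← ENNReal.ofReal_inv_of_pos (by positivity), ← ENNReal.ofReal_inv_of_pos (by linarith),
      ← ENNReal.ofReal_add (by positivity) (by positivity)]
    congr 1
    field_simp
    ring
  have : Fact (1 ≤ p / q) := by
    refine ⟨?_⟩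
    rw [hr, ENNReal.one_le_ofReal, le_div_iff₀ (by linarith)]
    linarith
  have hw : MemLp (fun a => ((‖G a‖ ^ q.toReal : ℝ) : 𝕜)) (p / q) μ :=
    ((Lp.memLp G).norm_rpow_div q).ofReal
  refine ⟨((ContinuousLinearMap.mul 𝕜 𝕜).holderL μ p (p / q) 2).flip (hw.toLp _), fun f hf x hx => ?_⟩
  rw [ContinuousLinearMap.flip_apply, ContinuousLinearMap.holderL_apply_apply] at hf
  filter_upwards [ContinuousLinearMap.coeFn_holder (r := 2) (ContinuousLinearMap.mul 𝕜 𝕜) f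
    (hw.toLp _), hw.coeFn_toLp, Lp.eq_zero_iff_ae_eq_zero.1 hf, hGx ⟨x, hx⟩] with a h1 h2 h3 h4
  rw [h3, h2, Pi.zero_apply, ContinuousLinearMap.mul_apply', eq_comm, mul_eq_zero] at h1
  refine h1.imp_right fun h => h4 ?_
  rw [RCLike.ofReal_eq_zero, hqr, Real.rpow_eq_zero (norm_nonneg _) (by linarith)] at h
  exact norm_eq_zero.1 h

/-- A closed subspace of `L_p`, `p > 2`, without an injective bounded operator into a Hilbert space
contains normalized disjoint families of cardinality `ℵ₁`. -/
theorem MeasureTheory.Lp.exists_disjoint_of_not_injective {𝕜 : Type w} [RCLike 𝕜] {Ω : Type u}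
    [MeasurableSpace Ω] {μ : Measure Ω} {p : ℝ≥0∞} [Fact (1 ≤ p)] (hp : 2 < p) (hp_top : p < ∞)
    {ι : Type v} (hι : Cardinal.mk ι = Cardinal.aleph 1) (X : Submodule 𝕜 (Lp 𝕜 p μ))
    (h : ¬ ∃ T : X →L[𝕜] Lp 𝕜 2 μ, Function.Injective T) :
    ∃ x : ι → Lp 𝕜 p μ, (∀ i, x i ∈ X) ∧ (∀ i, ‖x i‖ = 1) ∧
      Pairwise fun i j => AEDisjointSupport (x i) (x j) := by
  obtain ⟨F, hFX, hFd, hmax⟩ := exists_maximal_disjoint X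
  have hunc : ¬ F.Countable := by
    intro hF
    obtain ⟨T, hT⟩ := exists_toL2_of_countable hp hp_top hF
    refine h ⟨T.comp X.subtypeL, (injective_iff_map_eq_zero _).2 fun f hf => ?_⟩
    exact Subtype.ext (hmax f f.2 fun x hx => hT f hf x hx)
  rw [← Cardinal.le_aleph0_iff_set_countable, not_le, ← Cardinal.aleph_one_le_iff] at hunc
  -- `ι` and `F` live in different universes, so the cardinals are compared after lifting.
  have hle : Cardinal.lift.{max u w} (Cardinal.mk ι) ≤ Cardinal.lift.{v} (Cardinal.mk F) := by
    rw [hι, Cardinal.lift_aleph, Ordinal.lift_one]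
    have := Cardinal.lift_le.{v}.2 hunc
    rwa [Cardinal.lift_aleph, Ordinal.lift_one] at this
  obtain ⟨e⟩ := Cardinal.lift_mk_le'.1 hle
  exact ⟨fun i => e i, fun i => (hFX _ (e i).2).1, fun i => (hFX _ (e i).2).2,
    fun i j hij => hFd (e i).2 (e j).2 fun h => hij (e.injective (Subtype.ext h))⟩

/-! ### The equivalences -/

theorem proposition1 {𝕜 : Type w} [RCLike 𝕜]
    {Ω : Type u} [MeasurableSpace Ω] (μ : Measure Ω)
    (p : ℝ≥0∞) [Fact (1 ≤ p)] (hp : 2 < p) (hp_top : p < ∞)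
    {ι : Type v} (hι : Cardinal.mk ι = Cardinal.aleph 1)
    (X : Submodule 𝕜 (Lp 𝕜 p μ)) (hX : IsClosed (X : Set (Lp 𝕜 p μ))) :
    List.TFAE [
      Nonempty (lp (fun _ : ι => 𝕜) p →ₗᵢ[𝕜] X),
      ∃ Y : Submodule 𝕜 (Lp 𝕜 p μ), Y ≤ X ∧
        Nonempty (lp (fun _ : ι => 𝕜) p ≃L[𝕜] Y) ∧ Y.ClosedComplemented,
      ∃ Y : Submodule 𝕜 (Lp 𝕜 p μ), Y ≤ X ∧
        Nonempty (lp (fun _ : ι => 𝕜) p ≃L[𝕜] Y),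
      ¬ ∃ (H : Type (max u w)) (_ : NormedAddCommGroup H) (_ : InnerProductSpace 𝕜 H)
          (_ : CompleteSpace H) (T : X →L[𝕜] H), Function.Injective T] := by
  tfae_have 1 → 3 := by
    rintro ⟨J⟩
    let J' : lp (fun _ : ι => 𝕜) p →ₗᵢ[𝕜] Lp 𝕜 p μ := X.subtypeₗᵢ.comp J
    refine ⟨LinearMap.range J'.toLinearMap, ?_, ⟨J'.equivRange.toContinuousLinearEquiv⟩⟩
    rintro _ ⟨c, rfl⟩
    exact (J c).2
  tfae_have 2 → 3 := fun ⟨Y, hYX, hY, _⟩ => ⟨Y, hYX, hY⟩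
  tfae_have 3 → 4 := by
    rintro ⟨Y, hYX, ⟨e⟩⟩ ⟨H, _, _, _, T, hT⟩
    have : Uncountable ι := by
      rw [← Cardinal.aleph0_lt_mk_iff, hι]
      exact Cardinal.aleph0_lt_aleph_one
    let A : Y →L[𝕜] X := Y.subtypeL.codRestrict X fun y => hYX y.2
    have hA : Function.Injective A := fun a b hab =>
      Subtype.ext (congrArg (fun z : X => (z : Lp 𝕜 p μ)) hab)
    exact lp.not_injective_of_uncountable hp hp_top (T.comp (A.comp e.toContinuousLinearMap))
      (hT.comp (hA.comp e.injective))
  have family : (¬ ∃ (H : Type (max u w)) (_ : NormedAddCommGroup H) (_ : InnerProductSpace 𝕜 H)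
      (_ : CompleteSpace H) (T : X →L[𝕜] H), Function.Injective T) →
      ∃ x : ι → Lp 𝕜 p μ, (∀ i, x i ∈ X) ∧ (∀ i, ‖x i‖ = 1) ∧
        Pairwise fun i j => Lp.AEDisjointSupport (x i) (x j) := fun h =>
    -- `L_2(μ)` lies in the universe `max u w` over which (4) quantifies, so it is an admissible
    -- `H`.
    Lp.exists_disjoint_of_not_injective hp hp_top hι X fun ⟨T, hT⟩ =>
      h ⟨Lp 𝕜 2 μ, inferInstance, inferInstance, inferInstance, T, hT⟩
  tfae_have 4 → 1 := by
    intro h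
    obtain ⟨x, hxX, hx, hd⟩ := family h
    exact ⟨⟨(Lp.lpEmbedding hp_top.ne hx hd).toLinearMap.codRestrict X
      (Lp.lpEmbedding_mem hp_top.ne hx hd hX hxX), (Lp.lpEmbedding hp_top.ne hx hd).norm_map⟩⟩
  tfae_have 4 → 2 := by
    intro h
    obtain ⟨x, hxX, hx, hd⟩ := family h
    refine ⟨_, ?_, ⟨(Lp.lpEmbedding hp_top.ne hx hd).equivRange.toContinuousLinearEquiv⟩,
      Lp.closedComplemented_range_lpEmbedding hp_top.ne hx hd⟩
    rintro _ ⟨c, rfl⟩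
    exact Lp.lpEmbedding_mem hp_top.ne hx hd hX hxX c
  tfae_finish
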